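/- Let $p$ be a prime and let $G$ be a finite $p$-solvable group, i.e. a finite group having a series $1=N_0\le N_1\le\cdots\le N_n=G$ of normal subgroups of $G$ such that each factor $N_{i+1}/N_i$ is either a $p$-group or a group of order not divisible by $p$. Let $P$ be a Sylow $p$-subgroup of $G$, let $n_p(G)$ be the number of Sylow $p$-subgroups of $G$, and let $\mathfrak{U}_p(G)$ be the set of $p$-elements of $G$, i.e. the union of all Sylow $p$-subgroups of $G$. Then $$\frac{|\mathfrak{U}_p(G)|}{|P|}\;\ge\; n_p(G)^{\frac{p-1}{p}}.$$ -/

import Mathlib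

/-- The set of `p`-elements of `G`, i.e. the union of the Sylow `p`-subgroups of `G`. -/
def pElements (p : ℕ) (G : Type*) [Group G] : Set G :=
  ⋃ Q : Sylow p G, (Q : Set G)

/-- A finite group `G` is `p`-solvable if it has a series `1 = N 0 ≤ N 1 ≤ ⋯ ≤ N n = G` of normal
subgroups of `G` in which every factor `N (i + 1) / N i` is a `p`-group (its order is a power of
`p`) or a `p'`-group (its order is not divisible by `p`). The order of the factor
`N (i + 1) / N i` is `(N i).relIndex (N (i + 1))`. -/
def IsPSolvable (p : ℕ) (G : Type*) [Group G] : Prop :=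
  ∃ (n : ℕ) (N : ℕ → Subgroup G),
    N 0 = ⊥ ∧ N n = ⊤ ∧ (∀ i ≤ n, (N i).Normal) ∧
      ∀ i < n, N i ≤ N (i + 1) ∧
        ((∃ k : ℕ, (N i).relIndex (N (i + 1)) = p ^ k) ∨ ¬ p ∣ (N i).relIndex (N (i + 1)))

/-! Let s(x) be the number of Sylow p-subgroups containing x. Weighting each x in each Sylow
subgroup by 1/s(x) counts every p-element once, so the number of p-elements is at least the sum over
Q of the sum over x in Q of 1/s(x). By AM-GM the theorem follows once the geometric mean of s over P
is at most n_p(G)^(1/p), which is `SylowProdBound`.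

That bound passes up the series from G/K to G. If K is a normal p-subgroup, s does not change. If K
is a normal p'-subgroup, s(x)|C_K(P)| = s(xK)|C_K(x)|, so what is needed is `FixedPointBound` for P
acting on K by conjugation.

For a p-group A acting on a p'-group N, that bound is proved one prime q at a time on an A-invariant
Sylow q-subgroup, and then by invariant normal subgroups down to an irreducible abelian group. There
a nontrivial action has a central element c of order p in its image without nontrivial fixed points,
and the p subgroups C_N(ac^i) are independent, so the product of their orders divides |N|. -/

/-! ### Coprime actions: fixed points and extensions. -/

section CoprimeAction

open MulAction

/-- The subgroup of elements of `N` fixed by `a`. -/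
def fixedBySubgroup (N : Type*) {A : Type*} [Group A] [Group N] [MulDistribMulAction A N] (a : A) :
    Subgroup N :=
  (MulDistribMulAction.toMonoidHom N a).eqLocus (MonoidHom.id N)

/-- The action on a subgroup that is mapped into itself. -/
abbrev restrictedAction {A N : Type*} [Group A] [Group N] [MulDistribMulAction A N]
    (H : Subgroup N) (h : ∀ (a : A), ∀ n ∈ H, a • n ∈ H) : MulDistribMulAction A H where
  smul a n := ⟨a • (n : N), h a n n.2⟩
  one_smul n := Subtype.ext (one_smul A (n : N))
  mul_smul a b n := Subtype.ext (mul_smul a b (n : N))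
  smul_mul a m n := Subtype.ext (smul_mul' a (m : N) (n : N))
  smul_one a := Subtype.ext (smul_one a)

/-- The action on the quotient by a normal subgroup that is mapped into itself. -/
abbrev quotientAction {A N : Type*} [Group A] [Group N] [MulDistribMulAction A N]
    (M : Subgroup N) [M.Normal] (h : ∀ (a : A), ∀ n ∈ M, a • n ∈ M) :
    MulDistribMulAction A (N ⧸ M) where
  smul a := QuotientGroup.map M M (MulDistribMulAction.toMonoidHom N a) (fun n hn => h a n hn)
  one_smul x := by
    induction x using QuotientGroup.induction_on with
    | H n => exact congrArg _ (one_smul A n)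
  mul_smul a b x := by
    induction x using QuotientGroup.induction_on with
    | H n => exact congrArg _ (mul_smul a b n)
  smul_mul a x y := map_mul _ x y
  smul_one a := map_one _

variable {A N : Type*} [Group A] [Group N] [MulDistribMulAction A N]

theorem mem_fixedBySubgroup {a : A} {n : N} : n ∈ fixedBySubgroup N a ↔ a • n = n := Iff.rfl

theorem smul_mem_iff_of_invariant {H : Subgroup N} (h : ∀ (a : A), ∀ n ∈ H, a • n ∈ H) (a : A)
    (n : N) : a • n ∈ H ↔ n ∈ H :=
  ⟨fun hn => by simpa using h a⁻¹ _ hn, h a n⟩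

/-- A `p`-group acting on an invariant set of order prime to `p` has a fixed point in it. -/
theorem IsPGroup.exists_fixed_mem {p : ℕ} [Fact p.Prime] {X : Type*} [MulAction A X]
    (hA : IsPGroup p A) (T : Set X) (hT : ∀ (a : A), ∀ n ∈ T, a • n ∈ T)
    (hp : ¬ p ∣ Nat.card T) : ∃ n ∈ T, ∀ a : A, a • n = n := by
  let S : SubMulAction A X := ⟨T, fun a {n} hn => hT a n hn⟩
  obtain ⟨x, hx⟩ := hA.nonempty_fixed_point_of_prime_not_dvd_card S hp
  exact ⟨x, x.2, fun a => congrArg Subtype.val (hx a)⟩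

theorem Subgroup.card_eq_card_subgroupOf_mul_card_map {G : Type*} [Group G] (H M : Subgroup G)
    [M.Normal] : Nat.card H =
      Nat.card (H.subgroupOf M) * Nat.card (H.map (QuotientGroup.mk' M)) := by
  rw [← Subgroup.relIndex_ker, QuotientGroup.ker_mk', ← Subgroup.card_mul_index (M.subgroupOf H),
    Subgroup.relIndex]
  congr 1
  refine Nat.card_congr ⟨fun x => ⟨⟨x.1.1, x.2⟩, x.1.2⟩, fun x => ⟨⟨x.1.1, x.2⟩, x.1.2⟩,
    fun _ => rfl, fun _ => rfl⟩

/-- The average over `A` of the "logarithm" of the number of fixed points is at most `1/p`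
of the way from the number of common fixed points to the order of `N`. -/
def FixedPointBound (p : ℕ) (A N : Type*) [Group A] [Group N] [MulDistribMulAction A N] : Prop :=
  (∏ᶠ a : A, Nat.card (fixedBySubgroup N a)) ^ p ∣
    Nat.card N ^ Nat.card A * Nat.card (FixedPoints.subgroup A N) ^ ((p - 1) * Nat.card A)

/-- The two bounds multiply: |C_N(a)| divides |C_M(a)||C_{N/M}(a)| for any action, and coprimality
makes |C_M(A)||C_{N/M}(A)| divide |C_N(A)|. -/
theorem FixedPointBound.of_invariant_normal {p : ℕ} [Fact p.Prime] [Finite A] [Finite N]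
    (hA : IsPGroup p A) (hN : ¬ p ∣ Nat.card N) (M : Subgroup N) [M.Normal]
    (h : ∀ (a : A), ∀ n ∈ M, a • n ∈ M)
    (h₁ : letI := restrictedAction M h; FixedPointBound p A M)
    (h₂ : letI := quotientAction M h; FixedPointBound p A (N ⧸ M)) : FixedPointBound p A N := by
  let _ := restrictedAction M h
  let _ := quotientAction M h
  change FixedPointBound p A M at h₁
  change FixedPointBound p A (N ⧸ M) at h₂
  have := Fintype.ofFinite A
  have smul_mk (a : A) (n : N) : a • (n : N ⧸ M) = ((a • n : N) : N ⧸ M) := rfl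
  have e₁ (a : A) : Nat.card (fixedBySubgroup N a) ∣
      Nat.card (fixedBySubgroup M a) * Nat.card (fixedBySubgroup (N ⧸ M) a) := by
    rw [Subgroup.card_eq_card_subgroupOf_mul_card_map _ M]
    refine mul_dvd_mul ?_ (Subgroup.card_dvd_of_le ?_)
    · refine Subgroup.card_dvd_of_le fun n hn => Subtype.ext hn
    · rintro _ ⟨n, hn, rfl⟩
      exact congrArg _ hn
  have e₂ : Nat.card (FixedPoints.subgroup A M) * Nat.card (FixedPoints.subgroup A (N ⧸ M)) ∣
      Nat.card (FixedPoints.subgroup A N) := by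
    rw [Subgroup.card_eq_card_subgroupOf_mul_card_map (FixedPoints.subgroup A N) M]
    refine mul_dvd_mul ?_ (Subgroup.card_dvd_of_le ?_)
    · exact Subgroup.card_dvd_of_le fun n hn a => congrArg Subtype.val (hn a)
    · intro x hx
      induction x using QuotientGroup.induction_on with
      | H n =>
        -- An invariant coset has |M| elements, a number prime to p, so it contains a fixed point.
        obtain ⟨m, hm, hm'⟩ := hA.exists_fixed_mem {m : N | (m : N ⧸ M) = n}
          (fun a m hm => by
            change ((a • m : N) : N ⧸ M) = n
            rw [← smul_mk, show (m : N ⧸ M) = n from hm]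
            exact hx a) (by
            have hc : Nat.card {m : N | (m : N ⧸ M) = n} = Nat.card M := by
              refine Nat.card_congr ⟨fun m => ⟨n⁻¹ * m.1, QuotientGroup.eq.1 m.2.symm⟩,
                fun m => ⟨n * m.1, ?_⟩, fun m => ?_, fun m => ?_⟩
              · exact (QuotientGroup.eq.2 (by simp)).symm
              · simp
              · simp
            rw [hc]
            exact fun hd => hN (hd.trans (Subgroup.card_subgroup_dvd_card M)))
        exact ⟨m, hm', hm⟩
  have e₃ := mul_dvd_mul h₁ h₂
  unfold FixedPointBound
  simp only [finprod_eq_prod_of_fintype] at e₃ ⊢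
  refine (pow_dvd_pow_of_dvd (Finset.prod_dvd_prod_of_dvd _ _ fun a _ => e₁ a) p).trans ?_
  rw [Finset.prod_mul_distrib, mul_pow]
  refine e₃.trans ?_
  rw [mul_mul_mul_comm, ← mul_pow, ← mul_pow, mul_comm (Nat.card M),
    ← Subgroup.card_eq_card_quotient_mul_card_subgroup]
  exact mul_dvd_mul_left _ (pow_dvd_pow_of_dvd e₂ _)

end CoprimeAction

/-! ### Irreducible abelian case. -/

section AbelianCoprimeAction

open MulAction

/-- If `z` is an automorphism of order dividing `p` of an abelian group of order prime to `p`
without nontrivial fixed points, and `x` commutes with `z`, then the fixed point subgroups of the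
automorphisms `x * z ^ i` with `i < p` are independent. -/
theorem prod_card_fixedBySubgroup_dvd {p : ℕ} [Fact p.Prime] {N : Type*} [Group N] [Finite N]
    (hcomm : ∀ a b : N, a * b = b * a) (hN : ¬ p ∣ Nat.card N) (x z : MulAut N)
    (hxz : Commute x z) (hz : z ^ p = 1) (hfix : ∀ n : N, z • n = n → n = 1) :
    ∏ i : Fin p, Nat.card (fixedBySubgroup N (x * z ^ (i : ℕ))) ∣ Nat.card N := by
  let _ : CommGroup N := { ‹Group N› with mul_comm := hcomm }
  let f : ((i : Fin p) → fixedBySubgroup N (x * z ^ (i : ℕ))) →* N :=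
    { toFun := fun n => ∏ i, (n i : N)
      map_one' := by simp
      map_mul' := fun m n => by simp [Finset.prod_mul_distrib] }
  rw [← Nat.card_pi]
  refine Subgroup.card_dvd_of_injective f ((injective_iff_map_eq_one f).2 fun n hn => ?_)
  have hn : ∏ i, (n i : N) = 1 := hn
  funext k
  -- Apply (xz^k)^j to the relation: xz^k = z^(k-i)(xz^i) and xz^i fixes n_i, so only powers of
  -- z^(k-i) remain.
  have key (j : ℕ) : ∏ i, ((z ^ ((k : ℤ) - (i : Fin p))) ^ j) • (n i : N) = 1 := by
    have h1 : ∏ i, ((x * z ^ (k : ℕ)) ^ j) • (n i : N) = 1 := by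
      rw [← Finset.smul_prod', hn, smul_one]
    rw [← h1]
    refine Finset.prod_congr rfl fun i _ => ?_
    have h2 : x * z ^ (k : ℕ) = z ^ ((k : ℤ) - i) * (x * z ^ (i : ℕ)) := by
      rw [← mul_assoc, ← (hxz.zpow_right _).eq, mul_assoc, ← zpow_natCast, ← zpow_natCast,
        ← zpow_add]
      simp
    have h3 : Commute (z ^ ((k : ℤ) - i)) (x * z ^ (i : ℕ)) :=
      ((hxz.zpow_right _).mul_left
        (((Commute.refl z).pow_left _).zpow_right _)).symm
    have h4 : (x * z ^ (i : ℕ)) ^ j ∈ stabilizer (MulAut N) (n i : N) :=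
      Subgroup.pow_mem _ (show _ ∈ stabilizer (MulAut N) (n i : N) from (n i).2) j
    rw [h2, h3.mul_pow, mul_smul, mem_stabilizer_iff.1 h4]
  have hprod : ∏ i, ∏ j ∈ Finset.range p, ((z ^ ((k : ℤ) - (i : Fin p))) ^ j) • (n i : N) = 1 := by
    rw [Finset.prod_comm]
    exact Finset.prod_eq_one fun j _ => key j
  -- The factor i = k is n_k^p. Any other factor is a product over all powers of a generator of ⟨z⟩,
  -- hence fixed by z and trivial.
  rw [Finset.prod_eq_single k] at hprod
  · have h5 : (n k : N) ^ p = 1 := by simpa using hprod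
    have h6 : orderOf (n k : N) = 1 := by
      rcases (Nat.dvd_prime Fact.out).1 (orderOf_dvd_of_pow_eq_one h5) with h | h
      · exact h
      · exact (hN (h ▸ orderOf_dvd_natCard (n k : N))).elim
    exact Subtype.ext (orderOf_eq_one_iff.1 h6)
  · intro i _ hik
    apply hfix
    set w := z ^ ((k : ℤ) - i) with hw
    set m := ∏ j ∈ Finset.range p, (w ^ j) • (n i : N) with hm
    have hwm : w ∈ stabilizer (MulAut N) m := by
      have hwp : w ^ p = 1 := by
        rw [hw, ← zpow_natCast, ← zpow_mul, mul_comm, zpow_mul, zpow_natCast, hz, one_zpow]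
      have h7 := Finset.prod_range_succ (fun j => (w ^ j) • (n i : N)) p
      rw [Finset.prod_range_succ', hwp, pow_zero] at h7
      have h8 := mul_right_cancel h7
      rw [mem_stabilizer_iff, hm, Finset.smul_prod', ← h8]
      simp [pow_succ']
    obtain ⟨u, v, huv⟩ : IsCoprime ((k : ℤ) - i) p := by
      refine IsCoprime.symm ((Prime.coprime_iff_not_dvd
        (Nat.prime_iff_prime_int.1 (Fact.out : p.Prime))).2 fun hd => hik ?_)
      have := Int.eq_zero_of_abs_lt_dvd hd (by
        have := k.2
        have := i.2
        rw [abs_lt]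
        omega)
      exact Fin.ext (by omega)
    have hzw : z = w ^ u := by
      calc z = z ^ (u * ((k : ℤ) - i) + v * p) := by rw [huv, zpow_one]
        _ = w ^ u := by
          rw [zpow_add, mul_comm v, zpow_mul z p, zpow_natCast, hz, one_zpow, mul_one, mul_comm,
            zpow_mul]
    exact mem_stabilizer_iff.1 (hzw ▸ Subgroup.zpow_mem _ hwm u : z ∈ stabilizer (MulAut N) m)
  · simp

variable {p : ℕ} [Fact p.Prime] {A N : Type*} [Group A] [Group N] [MulDistribMulAction A N]

theorem FixedPointBound.of_trivial [Finite A] (h : ∀ (a : A) (n : N), a • n = n) :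
    FixedPointBound p A N := by
  have := Fintype.ofFinite A
  have h₁ (a : A) : fixedBySubgroup N a = ⊤ := eq_top_iff.2 fun n _ => h a n
  have h₂ : FixedPoints.subgroup A N = ⊤ := eq_top_iff.2 fun n _ a => h a n
  have hp : p = (p - 1) + 1 := (Nat.sub_add_cancel (Fact.out : p.Prime).one_le).symm
  simp only [FixedPointBound, h₁, h₂, Subgroup.card_top, finprod_eq_prod_of_fintype,
    Finset.prod_const, Finset.card_univ, ← Nat.card_eq_fintype_card]
  rw [← pow_mul, ← pow_add]
  refine pow_dvd_pow _ (le_of_eq ?_)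
  conv_lhs => rw [hp]
  ring

/-- The image of A in Aut(N), if nontrivial, has a central element of order p. Its fixed points form
an A-invariant proper subgroup, trivial by irreducibility. -/
theorem FixedPointBound.of_abelian_irreducible [Finite A] [Finite N] (hA : IsPGroup p A)
    (hN : ¬ p ∣ Nat.card N) (hcomm : ∀ a b : N, a * b = b * a)
    (hirr : ∀ H : Subgroup N, (∀ (a : A), ∀ n ∈ H, a • n ∈ H) → H = ⊥ ∨ H = ⊤) :
    FixedPointBound p A N := by
  have := Fintype.ofFinite A
  let φ := MulDistribMulAction.toMulAut A N
  have hφ (a : A) (n : N) : φ a • n = a • n := rfl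
  rcases subsingleton_or_nontrivial φ.range with hs | hs
  · refine .of_trivial fun a n => ?_
    have : (⟨φ a, a, rfl⟩ : φ.range) = 1 := Subsingleton.elim _ _
    rw [← hφ, show φ a = 1 from congrArg Subtype.val this, one_smul]
  have hR : IsPGroup p φ.range := hA.of_surjective φ.rangeRestrict φ.rangeRestrict_surjective
  have := hR.center_nontrivial
  have hp : p ∣ Nat.card (Subgroup.center φ.range) :=
    ((hR.to_subgroup _).nontrivial_iff_card.1 this).elim fun n hn => hn.2 ▸ dvd_pow_self p hn.1.ne'
  obtain ⟨⟨⟨z, c, rfl⟩, hz⟩, hord⟩ := exists_prime_orderOf_dvd_card' p hp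
  have hcp : φ c ^ p = 1 := by
    have := pow_orderOf_eq_one (⟨⟨φ c, c, rfl⟩, hz⟩ : Subgroup.center φ.range)
    rw [hord] at this
    exact congrArg (fun y => y.1.1) this
  have hc1 : φ c ≠ 1 := fun h => by
    have : (⟨⟨φ c, c, rfl⟩, hz⟩ : Subgroup.center φ.range) = 1 :=
      Subtype.ext (Subtype.ext h)
    rw [this, orderOf_one] at hord
    exact (Fact.out : p.Prime).one_lt.ne hord
  have hcc (a : A) : Commute (φ a) (φ c) :=
    congrArg Subtype.val (Subgroup.mem_center_iff.1 hz ⟨φ a, a, rfl⟩)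
  have hfix : ∀ n : N, φ c • n = n → n = 1 := by
    rcases hirr (fixedBySubgroup N c) (fun a n hn => by
      rw [mem_fixedBySubgroup] at hn ⊢
      rw [← hφ c, ← hφ a, smul_smul, ← (hcc a).eq, mul_smul, hφ c, hn]) with h | h
    · intro n hn
      have : n ∈ fixedBySubgroup N c := hn
      rwa [h, Subgroup.mem_bot] at this
    · refine (hc1 ?_).elim
      ext n
      exact (h ▸ Subgroup.mem_top n : n ∈ fixedBySubgroup N c)
  -- The factor |N|^|A| alone suffices. Since a ↦ ac^i permutes A, the p-th power regroups into
  -- products over i < p.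
  refine Dvd.dvd.mul_right ?_ _
  rw [finprod_eq_prod_of_fintype]
  have h₁ (i : Fin p) : ∏ a : A, Nat.card (fixedBySubgroup N a) =
      ∏ a : A, Nat.card (fixedBySubgroup N (φ a * φ c ^ (i : ℕ))) := by
    rw [← Equiv.prod_comp (Equiv.mulRight (c ^ (i : ℕ)))]
    refine Finset.prod_congr rfl fun a _ => ?_
    rw [← map_pow, ← map_mul]
    rfl
  calc (∏ a : A, Nat.card (fixedBySubgroup N a)) ^ p
      = ∏ i : Fin p, ∏ a : A, Nat.card (fixedBySubgroup N (φ a * φ c ^ (i : ℕ))) := by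
        rw [← Finset.prod_congr rfl fun i _ => h₁ i]
        simp
    _ = ∏ a : A, ∏ i : Fin p, Nat.card (fixedBySubgroup N (φ a * φ c ^ (i : ℕ))) :=
        Finset.prod_comm
    _ ∣ ∏ _a : A, Nat.card N := Finset.prod_dvd_prod_of_dvd _ _ fun a _ =>
        prod_card_fixedBySubgroup_dvd hcomm hN _ _ (hcc a) hcp hfix
    _ = Nat.card N ^ Nat.card A := by simp [Nat.card_eq_fintype_card]

end AbelianCoprimeAction

/-- Induction on a bound for |N|. If no proper nontrivial invariant normal subgroup exists, the
invariant centre is everything, so N is abelian and irreducible. -/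
theorem FixedPointBound.of_isPGroup {p q : ℕ} [Fact p.Prime] [Fact q.Prime] {A : Type*} [Group A]
    [Finite A] (hA : IsPGroup p A) (n : ℕ) : ∀ {N : Type*} [Group N] [Finite N]
    [MulDistribMulAction A N], Nat.card N ≤ n → ¬ p ∣ Nat.card N → IsPGroup q N →
      FixedPointBound p A N := by
  induction n with
  | zero => exact fun h => (Nat.card_pos.not_ge h).elim
  | succ n ih =>
    intro N _ _ _ hn hN hq
    by_cases hM : ∃ M : Subgroup N, M.Normal ∧ (∀ (a : A), ∀ n ∈ M, a • n ∈ M) ∧ M ≠ ⊥ ∧ M ≠ ⊤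
    · obtain ⟨M, hMn, hM, hbot, htop⟩ := hM
      have hcard := Subgroup.card_mul_index M
      have hM1 : 1 < Nat.card M := Subgroup.one_lt_card_iff_ne_bot M |>.2 hbot
      have hM2 : 1 < M.index := Subgroup.one_lt_index_of_ne_top htop
      have hd1 : Nat.card M ∣ Nat.card N := ⟨_, hcard.symm⟩
      have hd2 : Nat.card (N ⧸ M) ∣ Nat.card N := ⟨_, by rw [mul_comm]; exact hcard.symm⟩
      have hlt1 : Nat.card M < Nat.card N := by nlinarith
      have hlt2 : Nat.card (N ⧸ M) < Nat.card N := by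
        change M.index < _
        nlinarith
      refine .of_invariant_normal hA hN M hM ?_ ?_
      · exact @ih M _ _ (_) (by omega) (fun h => hN (h.trans hd1)) (hq.to_subgroup M)
      · exact @ih (N ⧸ M) _ _ (_) (by omega) (fun h => hN (h.trans hd2)) (hq.to_quotient M)
    · push Not at hM
      have hcomm : ∀ a b : N, a * b = b * a := by
        rcases subsingleton_or_nontrivial N with _ | _
        · exact fun _ _ => Subsingleton.elim _ _
        have hnt := hq.center_nontrivial
        have htop := hM (Subgroup.center N) inferInstance (fun a n hn => by
          rw [Subgroup.mem_center_iff] at hn ⊢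
          intro g
          have := congrArg (a • ·) (hn (a⁻¹ • g))
          simpa [smul_mul'] using this) ((Subgroup.nontrivial_iff_ne_bot _).1 hnt)
        intro a b
        exact Subgroup.mem_center_iff.1 (htop ▸ Subgroup.mem_top b) a
      refine .of_abelian_irreducible hA hN hcomm fun H hH => or_iff_not_imp_left.2 fun hb => ?_
      exact hM H ⟨fun m hm g => by rwa [hcomm g m, mul_assoc, mul_inv_cancel, mul_one]⟩ hH hb

/-! ### Invariant Sylow subgroups and the reduction to prime power order. -/

section CoprimeSylow

open MulAction

open scoped Pointwise

variable {p q : ℕ} [Fact p.Prime] [Fact q.Prime] {A N : Type*} [Group A] [Group N]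
  [MulDistribMulAction A N]

theorem Sylow.exists_invariant [Finite N] (hA : IsPGroup p A) (hN : ¬ p ∣ Nat.card N) :
    ∃ S : Sylow q N, ∀ (a : A), ∀ n ∈ S, a • n ∈ S := by
  obtain ⟨S, hS⟩ := hA.nonempty_fixed_point_of_prime_not_dvd_card (Sylow q N) fun h =>
    hN ((h.trans (default : Sylow q N).card_dvd_index).trans (Subgroup.index_dvd_card _))
  refine ⟨S, fun a n hn => ?_⟩
  have : a • n ∈ a • (S : Subgroup N) := Subgroup.smul_mem_pointwise_smul n a _ hn
  rw [← Sylow.pointwise_smul_def, hS a] at this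
  exact this

/-- A maximal invariant q-subgroup R is Sylow: an invariant Sylow subgroup of its normalizer
contains R, hence equals R, whereas q would divide [N(R) : R] if R were not Sylow in N. -/
theorem Sylow.exists_invariant_ge [Finite N] (hA : IsPGroup p A) (hN : ¬ p ∣ Nat.card N)
    {Q : Subgroup N} (hq : IsPGroup q Q) (hQ : ∀ (a : A), ∀ n ∈ Q, a • n ∈ Q) :
    ∃ S : Sylow q N, Q ≤ S ∧ ∀ (a : A), ∀ n ∈ S, a • n ∈ S := by
  obtain ⟨R, hQR, ⟨hRq, hR⟩, hmax⟩ := (Set.toFinite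
    {R : Subgroup N | IsPGroup q R ∧ ∀ (a : A), ∀ n ∈ R, a • n ∈ R}).exists_le_maximal ⟨hq, hQ⟩
  have hH : ∀ (a : A), ∀ n ∈ Subgroup.normalizer (R : Set N),
      a • n ∈ Subgroup.normalizer (R : Set N) := by
    intro a n hn
    rw [Subgroup.mem_normalizer_iff] at hn ⊢
    intro h
    rw [← smul_mem_iff_of_invariant hR a⁻¹ h, hn, ← smul_mem_iff_of_invariant hR a]
    simp [smul_mul']
  let _ := restrictedAction _ hH
  obtain ⟨T, hT⟩ := Sylow.exists_invariant (q := q) (N := Subgroup.normalizer (R : Set N)) hA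
    fun h => hN (h.trans (Subgroup.card_subgroup_dvd_card _))
  have hnormal : (R.subgroupOf (Subgroup.normalizer (R : Set N))).Normal :=
    Subgroup.normal_in_normalizer
  have hRT : R.subgroupOf (Subgroup.normalizer (R : Set N)) ≤
      (T : Subgroup (Subgroup.normalizer (R : Set N))) :=
    IsPGroup.le_sylow_of_normal (N := R.subgroupOf (Subgroup.normalizer (R : Set N)))
      (hRq.comap_of_injective _ (Subgroup.subtype_injective _)) T
  have hTR : (T : Subgroup (Subgroup.normalizer (R : Set N))).map (Subgroup.subtype _) ≤ R := by
    refine hmax ⟨IsPGroup.map T.isPGroup' _, ?_⟩ ?_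
    · rintro a _ ⟨n, hn, rfl⟩
      exact ⟨a • n, hT a n hn, rfl⟩
    · intro r hr
      exact ⟨⟨r, Subgroup.le_normalizer hr⟩, hRT hr, rfl⟩
  have hRT' : R.subgroupOf (Subgroup.normalizer (R : Set N)) = T :=
    le_antisymm hRT fun n hn => hTR ⟨n, hn, rfl⟩
  obtain ⟨n, hn⟩ := IsPGroup.iff_card.1 hRq
  have hndvd : ¬ q ^ (n + 1) ∣ Nat.card N := fun h => by
    have := Sylow.prime_dvd_card_quotient_normalizer h hn
    change q ∣ (R.subgroupOf (Subgroup.normalizer (R : Set N))).index at this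
    rw [hRT'] at this
    exact T.not_dvd_index this
  have hdvd : q ^ n ∣ Nat.card N := hn ▸ Subgroup.card_subgroup_dvd_card R
  rw [(Fact.out : q.Prime).pow_dvd_iff_le_factorization Nat.card_pos.ne'] at hndvd hdvd
  refine ⟨Sylow.ofCard R (by rw [hn]; congr 1; omega), hQR, hR⟩

/-- The elements carrying R to S form an invariant coset of the normalizer of R, of order prime to
p. -/
theorem Sylow.exists_fixed_smul_eq [Finite N] (hA : IsPGroup p A) (hN : ¬ p ∣ Nat.card N)
    (R S : Sylow q N) (hR : ∀ (a : A), ∀ n ∈ R, a • n ∈ R) (hS : ∀ (a : A), ∀ n ∈ S, a • n ∈ S) :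
    ∃ c : N, c • R = S ∧ ∀ a : A, a • c = c := by
  have hmem (c : N) : c • R = S ↔ ∀ n, n ∈ R ↔ c * n * c⁻¹ ∈ S := by
    constructor
    · rintro rfl n
      rw [← MulAut.conj_apply, ← MulAut.smul_def]
      exact (Subgroup.smul_mem_pointwise_smul_iff (a := MulAut.conj c) (S := (R : Subgroup N))).symm
    · intro h
      refine Sylow.ext (Subgroup.ext fun n => ?_)
      rw [Sylow.coe_subgroup_smul, Subgroup.mem_pointwise_smul_iff_inv_smul_mem]
      refine (h _).trans ?_
      rw [← map_inv, MulAut.smul_def, MulAut.conj_apply]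
      simp only [inv_inv, mul_assoc, mul_inv_cancel, mul_one, mul_inv_cancel_left]
      rfl
  obtain ⟨c₀, hc₀⟩ := MulAction.exists_smul_eq N R S
  refine hA.exists_fixed_mem {c : N | c • R = S} (fun a c hc => ?_) fun hp => hN (hp.trans ?_)
  · refine (hmem _).2 fun n => ?_
    have h₁ := smul_mem_iff_of_invariant (H := (R : Subgroup N)) hR a⁻¹ n
    have h₂ := smul_mem_iff_of_invariant (H := (S : Subgroup N)) hS a (c * (a⁻¹ • n) * c⁻¹)
    have h₃ := (hmem c).1 hc (a⁻¹ • n)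
    simp only [smul_mul', smul_inv_smul, smul_inv'] at h₂
    exact h₁.symm.trans (h₃.trans h₂.symm)
  · have : Nat.card {c : N | c • R = S} = Nat.card (stabilizer N R) := by
      refine Nat.card_congr ⟨fun c => ⟨c₀⁻¹ * c.1, ?_⟩, fun c => ⟨c₀ * c.1, ?_⟩, fun c => ?_,
        fun c => ?_⟩
      · rw [mem_stabilizer_iff, mul_smul, show c.1 • R = S from c.2, ← hc₀, inv_smul_smul]
      · rw [Set.mem_ofPred_eq, mul_smul, mem_stabilizer_iff.1 c.2, hc₀]
      · simp
      · simp
    rw [this]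
    exact Subgroup.card_subgroup_dvd_card _

/-- An invariant Sylow subgroup contains a Sylow subgroup of the fixed points of each element. -/
theorem factorization_card_fixedBySubgroup_le [Finite A] [Finite N] (hA : IsPGroup p A)
    (hN : ¬ p ∣ Nat.card N) (S : Sylow q N)
    (hS : ∀ (a : A), ∀ n ∈ (S : Subgroup N), a • n ∈ (S : Subgroup N)) (a : A) :
    letI := restrictedAction (S : Subgroup N) hS
    (Nat.card (fixedBySubgroup N a)).factorization q ≤
      (Nat.card (fixedBySubgroup (S : Subgroup N) a)).factorization q := by
  let _ := restrictedAction (S : Subgroup N) hS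
  change _ ≤ (Nat.card (fixedBySubgroup (S : Subgroup N) a)).factorization q
  let Q : Sylow q (fixedBySubgroup N a) := default
  have hfix (b : Subgroup.zpowers a) {n : N} (hn : n ∈ fixedBySubgroup N a) : b • n = n := by
    have : Subgroup.zpowers a ≤ stabilizer A n := by
      rw [Subgroup.zpowers_le]
      exact hn
    exact this b.2
  -- Q is only known to be invariant under ⟨a⟩, so just this subgroup acts here. Conjugation by an
  -- a-fixed c then embeds Q in C_S(a).
  have hZ : IsPGroup p (Subgroup.zpowers a) := hA.to_subgroup _
  obtain ⟨R, hQR, hR⟩ := Sylow.exists_invariant_ge (A := Subgroup.zpowers a) hZ hN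
    (Q := (Q : Subgroup _).map (Subgroup.subtype _)) (Q.isPGroup'.map _) (by
      rintro b _ ⟨n, hn, rfl⟩
      rw [Subgroup.subtype_apply, hfix b n.2]
      exact ⟨n, hn, rfl⟩)
  obtain ⟨c, rfl, hc⟩ := Sylow.exists_fixed_smul_eq hZ hN R S hR (fun b n hn => hS b n hn)
  have hca : a • c = c := hc ⟨a, Subgroup.mem_zpowers a⟩
  let f : Q →* fixedBySubgroup ((c • R : Sylow q N) : Subgroup N) a :=
    { toFun := fun x => ⟨⟨c * x.1.1 * c⁻¹,
          Subgroup.smul_mem_pointwise_smul x.1.1 (MulAut.conj c) (R : Subgroup N)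
            (hQR ⟨x.1, x.2, rfl⟩)⟩,
        Subtype.ext (by
          change a • (c * x.1.1 * c⁻¹) = c * x.1.1 * c⁻¹
          rw [smul_mul', smul_mul', smul_inv', hca, mem_fixedBySubgroup.1 x.1.2])⟩
      map_one' := by ext; simp
      map_mul' := fun x y => by ext; simp }
  have hf : Function.Injective f := fun x y hxy => by
    have : c * x.1.1 * c⁻¹ = c * y.1.1 * c⁻¹ := congrArg (fun z => z.1.1) hxy
    exact Subtype.ext (Subtype.ext (by simpa using this))
  have hd := Subgroup.card_dvd_of_injective f hf
  have hcard : Nat.card Q = _ := Q.card_eq_multiplicity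
  rwa [hcard, (Fact.out : q.Prime).pow_dvd_iff_le_factorization Nat.card_pos.ne'] at hd

/-- Compare q-adic valuations: those of the |C_N(a)| are attained in S, and the right-hand side only
grows from S to N. -/
theorem FixedPointBound.of_coprime [Finite A] [Finite N] (hA : IsPGroup p A)
    (hN : ¬ p ∣ Nat.card N) : FixedPointBound p A N := by
  have := Fintype.ofFinite A
  have hpos (a : A) : Nat.card (fixedBySubgroup N a) ≠ 0 := Nat.card_pos.ne'
  rw [FixedPointBound, finprod_eq_prod_of_fintype, ← Nat.factorization_prime_le_iff_dvd
    (pow_ne_zero _ (Finset.prod_ne_zero_iff.2 fun a _ => hpos a))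
    (mul_ne_zero (pow_ne_zero _ Nat.card_pos.ne') (pow_ne_zero _ Nat.card_pos.ne'))]
  intro q hq
  have : Fact q.Prime := ⟨hq⟩
  obtain ⟨S, hS⟩ := Sylow.exists_invariant (q := q) hA hN
  have hle := factorization_card_fixedBySubgroup_le hA hN S hS
  let _ := restrictedAction (S : Subgroup N) hS
  change ∀ a : A, _ ≤ (Nat.card (fixedBySubgroup (S : Subgroup N) a)).factorization q at hle
  have hpos' (a : A) : Nat.card (fixedBySubgroup (S : Subgroup N) a) ≠ 0 := Nat.card_pos.ne'
  have hB : FixedPointBound p A (S : Subgroup N) := .of_isPGroup hA _ le_rfl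
    (fun h => hN (h.trans (Subgroup.card_subgroup_dvd_card _))) S.isPGroup'
  have hfix : Nat.card (FixedPoints.subgroup A (S : Subgroup N)) ∣
      Nat.card (FixedPoints.subgroup A N) := by
    refine Subgroup.card_dvd_of_injective (((S : Subgroup N).subtype.comp
      (FixedPoints.subgroup A (S : Subgroup N)).subtype).codRestrict _
      fun x a => congrArg Subtype.val (x.2 a)) fun x y h => ?_
    have h' : (x : (S : Subgroup N)).1 = (y : (S : Subgroup N)).1 :=
      congrArg (fun z : FixedPoints.subgroup A N => (z : N)) h
    exact Subtype.ext (Subtype.ext h')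
  have hdvd := hB.trans (mul_dvd_mul
    (pow_dvd_pow_of_dvd (Subgroup.card_subgroup_dvd_card (S : Subgroup N)) (Nat.card A))
    (pow_dvd_pow_of_dvd hfix ((p - 1) * Nat.card A)))
  rw [finprod_eq_prod_of_fintype] at hdvd
  refine le_trans ?_ ((Nat.factorization_le_iff_dvd
    (pow_ne_zero _ (Finset.prod_ne_zero_iff.2 fun a _ => hpos' a))
    (mul_ne_zero (pow_ne_zero _ Nat.card_pos.ne') (pow_ne_zero _ Nat.card_pos.ne'))).2 hdvd q)
  rw [Nat.factorization_pow, Nat.factorization_pow, Nat.factorization_prod fun a _ => hpos a,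
    Nat.factorization_prod fun a _ => hpos' a]
  simp only [Finsupp.smul_apply, Finsupp.finsetSum_apply, smul_eq_mul]
  exact Nat.mul_le_mul_left _ (Finset.sum_le_sum fun a _ => hle a)

end CoprimeSylow

/-! ### Counting the Sylow subgroups that contain a given element. -/

section SylowCount

open MulAction

/-- The number of Sylow `p`-subgroups containing `x`. -/
noncomputable def sylowCount (p : ℕ) {G : Type*} [Group G] (x : G) : ℕ :=
  Nat.card {Q : Sylow p G // x ∈ Q}

/-- The geometric mean over a Sylow `p`-subgroup of the number of Sylow `p`-subgroups containing
an element is at most the `p`-th root of the number of all Sylow `p`-subgroups. -/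
def SylowProdBound (p : ℕ) (G : Type*) [Group G] : Prop :=
  ∀ P : Sylow p G, (∏ᶠ x : P, sylowCount p (x : G)) ^ p ≤ Nat.card (Sylow p G) ^ Nat.card P

theorem MonoidHom.finprod_comp_of_surjective {A B M : Type*} [Group A] [Group B] [Finite A]
    [Finite B] [CommMonoid M] (f : A →* B) (hf : Function.Surjective f) (F : B → M) :
    ∏ᶠ a, F (f a) = (∏ᶠ b, F b) ^ Nat.card f.ker := by
  classical
  have := Fintype.ofFinite A
  have := Fintype.ofFinite B
  rw [finprod_eq_prod_of_fintype, finprod_eq_prod_of_fintype, ← Finset.prod_pow,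
    ← Finset.prod_fiberwise Finset.univ f]
  refine Finset.prod_congr rfl fun b _ => ?_
  rw [Finset.prod_congr rfl (g := fun _ => F b) fun a ha => by rw [(Finset.mem_filter.1 ha).2],
    Finset.prod_const, MonoidHom.card_fiber_eq_of_mem_range f (hf b) ⟨1, map_one f⟩,
    Nat.card_eq_fintype_card, Fintype.card_subtype]
  simp only [MonoidHom.mem_ker]

/-- A normal p-subgroup lies in every Sylow subgroup, so taking images is a bijection that preserves
membership. -/
theorem sylowCount_eq_of_isPGroup_ker {p : ℕ} [Fact p.Prime] {G H : Type*} [Group G]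
    [Group H] [Finite G] {f : G →* H}
    (hf : Function.Surjective f) (hK : IsPGroup p f.ker) (x : G) :
    sylowCount p x = sylowCount p (f x) := by
  have hmem (Q : Sylow p G) (y : G) : y ∈ Q ↔ f y ∈ Q.mapSurjective hf := by
    refine ⟨fun hy => ⟨y, hy, rfl⟩, ?_⟩
    rintro ⟨z, hz, hzy⟩
    have hk : z⁻¹ * y ∈ f.ker := by simp [MonoidHom.mem_ker, hzy]
    simpa using mul_mem (show z ∈ Q from hz) (IsPGroup.le_sylow_of_normal hK Q hk)
  refine Nat.card_congr (Equiv.subtypeEquiv (Equiv.ofBijective (Sylow.mapSurjective hf)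
    ⟨fun P Q h => ?_, Sylow.mapSurjective_surjective hf p⟩) fun Q => hmem Q x)
  refine Sylow.ext (Subgroup.ext fun y => ?_)
  have := (hmem P y).trans (h ▸ (hmem Q y).symm)
  exact this

theorem sylowCount_one {p : ℕ} {G : Type*} [Group G] :
    sylowCount p (1 : G) = Nat.card (Sylow p G) :=
  Nat.card_congr (Equiv.subtypeUnivEquiv fun Q => one_mem Q)

theorem Sylow.eq_one_of_mem_of_mem {p : ℕ} [Fact p.Prime] {G : Type*} [Group G]
    (Q : Sylow p G) {K : Subgroup G} (hK : ¬ p ∣ Nat.card K) {g : G}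
    (hQ : g ∈ Q) (hg : g ∈ K) : g = 1 := by
  obtain ⟨n, hn⟩ := Q.isPGroup' ⟨g, hQ⟩
  have h₁ : orderOf g ∣ p ^ n := orderOf_dvd_of_pow_eq_one (congrArg Subtype.val hn)
  have h₂ : orderOf g ∣ Nat.card K := by
    rw [← Subgroup.orderOf_mk g hg]
    exact orderOf_dvd_natCard _
  have h₃ : Nat.Coprime (p ^ n) (Nat.card K) :=
    (((Fact.out : p.Prime).coprime_iff_not_dvd).2 hK).pow_left n
  exact orderOf_eq_one_iff.1 (Nat.eq_one_of_dvd_coprimes h₃ h₁ h₂)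

theorem Sylow.mem_smul_iff {p : ℕ} {G : Type*} [Group G] {Q : Sylow p G} {g x : G} :
    x ∈ g • Q ↔ g⁻¹ * x * g ∈ Q := by
  change x ∈ ((g • Q : Sylow p G) : Subgroup G) ↔ _
  rw [Sylow.coe_subgroup_smul, Subgroup.mem_pointwise_smul_iff_inv_smul_mem, ← map_inv,
    MulAut.smul_def, MulAut.conj_apply, inv_inv]
  rfl

theorem Sylow.mapSurjective_smul {p : ℕ} [Fact p.Prime] {G H : Type*} [Group G] [Group H]
    [Finite G] {f : G →* H} (hf : Function.Surjective f) (Q : Sylow p G) (g : G) :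
    (g • Q).mapSurjective hf = f g • Q.mapSurjective hf := by
  refine Sylow.ext (Subgroup.ext fun y => ?_)
  change y ∈ (g • Q).mapSurjective hf ↔ y ∈ f g • Q.mapSurjective hf
  rw [Sylow.mem_smul_iff]
  constructor
  · rintro ⟨x, hx, rfl⟩
    exact ⟨g⁻¹ * x * g, Sylow.mem_smul_iff.1 hx, by simp⟩
  · rintro ⟨x, hx, hxy⟩
    refine ⟨g * x * g⁻¹, Sylow.mem_smul_iff.2 (by simpa [mul_assoc] using hx), ?_⟩
    simp [hxy, mul_assoc]

variable {p : ℕ} [Fact p.Prime] {G H : Type*} [Group G] [Group H] [Finite G]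
  {f : G →* H}

theorem SylowProdBound.comp_surjective [Finite H] (hf : Function.Surjective f)
    (hH : SylowProdBound p H)
    (P : Sylow p G) :
    (∏ᶠ x : P, sylowCount p (f x)) ^ p ≤ Nat.card (Sylow p H) ^ Nat.card P := by
  let φ : P →* P.mapSurjective hf :=
    (f.comp (P : Subgroup G).subtype).codRestrict ((P.mapSurjective hf : Sylow p H) : Subgroup H)
      fun x => ⟨x, x.2, rfl⟩
  have hφ : Function.Surjective φ := by
    rintro ⟨_, x, hx, rfl⟩
    exact ⟨⟨x, hx⟩, rfl⟩
  have hcard : Nat.card (P.mapSurjective hf) * Nat.card φ.ker = Nat.card P := by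
    rw [← Subgroup.card_mul_index φ.ker, mul_comm, Subgroup.index_ker,
      MonoidHom.range_eq_top.2 hφ, Subgroup.card_top]
  have h := φ.finprod_comp_of_surjective hφ fun y => sylowCount p (y : H)
  change ∏ᶠ x : P, sylowCount p (f x) = _ at h
  rw [h, pow_right_comm, ← hcard, pow_mul]
  exact Nat.pow_le_pow_left (hH _) _

theorem SylowProdBound.of_isPGroup_ker [Finite H] (hf : Function.Surjective f)
    (hK : IsPGroup p f.ker)
    (hH : SylowProdBound p H) : SylowProdBound p G := by
  intro P
  have h := hH.comp_surjective hf P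
  -- Equality of the counts at 1 says that G and H have equally many Sylow subgroups.
  rw [← sylowCount_one, ← map_one f, ← sylowCount_eq_of_isPGroup_ker hf hK, sylowCount_one] at h
  simpa only [sylowCount_eq_of_isPGroup_ker hf hK] using h

/-- Two Sylow subgroups inside `L` are conjugate by an element of `L`. -/
theorem Sylow.exists_mem_smul_eq_of_le {L : Subgroup G} (Q R : Sylow p G)
    (hQ : (Q : Subgroup G) ≤ L) (hR : (R : Subgroup G) ≤ L) : ∃ l ∈ L, l • Q = R := by
  obtain ⟨l, hl⟩ := MulAction.exists_smul_eq L (Q.subtype hQ) (R.subtype hR)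
  rw [Sylow.smul_subtype] at hl
  exact ⟨l, l.2, Sylow.subtype_injective hl⟩

/-- Work in the preimage L of Q: the p-group ⟨x⟩ lies in an L-conjugate of any lift of Q, and such a
conjugate has the same image. -/
theorem Sylow.exists_mem_mapSurjective_eq (hf : Function.Surjective f) {x : G} {P : Sylow p G}
    (hx : x ∈ P) {Q : Sylow p H} (hQ : f x ∈ Q) :
    ∃ R : Sylow p G, x ∈ R ∧ R.mapSurjective hf = Q := by
  obtain ⟨R, rfl⟩ := Sylow.mapSurjective_surjective hf p Q
  set L := ((R.mapSurjective hf : Sylow p H) : Subgroup H).comap f with hL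
  have hRL : (R : Subgroup G) ≤ L := fun y hy => ⟨y, hy, rfl⟩
  have hxL : x ∈ L := hQ
  have hZ : IsPGroup p (Subgroup.zpowers (⟨x, hxL⟩ : L)) := by
    have h₁ : IsPGroup p ((P : Subgroup G).subgroupOf L) :=
      P.isPGroup'.comap_of_injective _ (Subgroup.subtype_injective _)
    exact h₁.to_le (by rw [Subgroup.zpowers_le]; exact hx)
  obtain ⟨T, hT⟩ := hZ.exists_le_sylow
  obtain ⟨l, hl⟩ := MulAction.exists_smul_eq L (R.subtype hRL) T
  rw [Sylow.smul_subtype] at hl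
  refine ⟨(l : G) • R, ?_, ?_⟩
  · have h₂ : (⟨x, hxL⟩ : L) ∈ (T : Subgroup L) := hT (Subgroup.mem_zpowers _)
    rw [← hl] at h₂
    exact h₂
  · rw [Sylow.mapSurjective_smul, Sylow.smul_eq_iff_mem_normalizer]
    exact Subgroup.le_normalizer l.2

/-- Orbit-stabilizer for C_K(x), K the kernel: it is transitive on this fibre, and the stabilizer of
Q is C_K(Q). -/
theorem Sylow.card_mapSurjective_fiber_mul (hf : Function.Surjective f) (hK : ¬ p ∣ Nat.card f.ker)
    {x : G} {Q : Sylow p G} (hx : x ∈ Q) :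
    Nat.card {R : Sylow p G // x ∈ R ∧ R.mapSurjective hf = Q.mapSurjective hf} *
      Nat.card (f.ker ⊓ Subgroup.centralizer (Q : Set G) : Subgroup G) =
      Nat.card (f.ker ⊓ Subgroup.centralizer {x} : Subgroup G) := by
  classical
  set C : Subgroup G := f.ker ⊓ Subgroup.centralizer {x} with hC
  have horb : orbit C Q = {R | x ∈ R ∧ R.mapSurjective hf = Q.mapSurjective hf} := by
    ext R
    constructor
    · rintro ⟨⟨k, hk, hkx⟩, rfl⟩
      have hkx : x * k = k * x := Subgroup.mem_centralizer_singleton_iff.1 hkx |>.symm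
      change x ∈ k • Q ∧ (k • Q).mapSurjective hf = _
      rw [Sylow.mem_smul_iff, Sylow.mapSurjective_smul, MonoidHom.mem_ker.1 hk, one_smul, mul_assoc,
        hkx, inv_mul_cancel_left]
      exact ⟨hx, rfl⟩
    · rintro ⟨hxR, hR⟩
      obtain ⟨l, ⟨y, hy, hyl⟩, rfl⟩ := Sylow.exists_mem_smul_eq_of_le
        (L := ((Q.mapSurjective hf : Sylow p H) : Subgroup H).comap f) Q R
        (fun y hy => ⟨y, hy, rfl⟩) (fun y hy => by rw [← hR]; exact ⟨y, hy, rfl⟩)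
      -- Since f(l) = f(y) with y in Q, the conjugator can be corrected to lie in the kernel.
      have hk : l * y⁻¹ ∈ f.ker := by simp [MonoidHom.mem_ker, hyl]
      have hQk : (l * y⁻¹) • Q = l • Q := by
        rw [mul_smul, Sylow.smul_eq_iff_mem_normalizer.2
          (Subgroup.le_normalizer (inv_mem hy) : y⁻¹ ∈ _)]
      rw [← hQk] at hxR ⊢
      set k := l * y⁻¹
      have hq := Sylow.mem_smul_iff.1 hxR
      -- This commutator lies in both the p-group Q and the p'-group K, so it is trivial.
      have h₁ : x⁻¹ * (k⁻¹ * x * k) ∈ Q := mul_mem (inv_mem hx) hq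
      have h₂ : x⁻¹ * (k⁻¹ * x * k) ∈ f.ker := by
        simp [MonoidHom.mem_ker, MonoidHom.mem_ker.1 hk]
      have h₃ := Sylow.eq_one_of_mem_of_mem Q hK h₁ h₂
      refine ⟨⟨k, hk, Subgroup.mem_centralizer_singleton_iff.2 ?_⟩, rfl⟩
      have h₄ := inv_mul_eq_one.1 h₃
      rw [mul_assoc, eq_inv_mul_iff_mul_eq] at h₄
      exact h₄
  have hstab : Nat.card (stabilizer C Q) =
      Nat.card (f.ker ⊓ Subgroup.centralizer (Q : Set G) : Subgroup G) := by
    have hiff (k : G) (hk : k ∈ f.ker) :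
        k • Q = Q ↔ k ∈ Subgroup.centralizer (Q : Set G) := by
      rw [Subgroup.mem_centralizer_iff]
      constructor
      · intro h y hy
        have h₁ : y⁻¹ * (k⁻¹ * y * k) ∈ Q :=
          mul_mem (inv_mem hy) (Sylow.mem_smul_iff.1 (h.symm ▸ hy))
        have h₂ : y⁻¹ * (k⁻¹ * y * k) ∈ f.ker := by
          simp [MonoidHom.mem_ker, MonoidHom.mem_ker.1 hk]
        have h₄ := inv_mul_eq_one.1 (Sylow.eq_one_of_mem_of_mem Q hK h₁ h₂)
        rw [mul_assoc, eq_inv_mul_iff_mul_eq] at h₄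
        exact h₄.symm
      · intro h
        refine Sylow.ext (Subgroup.ext fun y => ?_)
        change y ∈ k • Q ↔ y ∈ Q
        rw [Sylow.mem_smul_iff]
        constructor
        · intro hy
          have := h _ hy
          have h₅ : k⁻¹ * y * k = y := by
            have h₆ : y * k = k⁻¹ * y * k * k := by simpa [mul_assoc] using this.symm
            exact (mul_right_cancel h₆).symm
          rwa [h₅] at hy
        · intro hy
          rwa [mul_assoc, h y hy, inv_mul_cancel_left]
    refine Nat.card_congr ⟨fun k => ⟨k.1.1, k.1.2.1, (hiff _ k.1.2.1).1 k.2⟩,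
      fun k => ⟨⟨k.1, k.2.1, ?_⟩, (hiff _ k.2.1).2 k.2.2⟩, fun _ => rfl, fun _ => rfl⟩
    exact Subgroup.mem_centralizer_singleton_iff.2
      (Subgroup.mem_centralizer_iff.1 k.2.2 x hx).symm
  have := Fintype.ofFinite C
  have := Fintype.ofFinite (orbit C Q)
  have := Fintype.ofFinite (stabilizer C Q)
  have hmain := card_orbit_mul_card_stabilizer_eq_card_group C Q
  simp only [← Nat.card_eq_fintype_card] at hmain
  rw [← hmain, hstab, horb]
  rfl

theorem Sylow.card_inf_centralizer_le (P Q : Sylow p G) (K : Subgroup G) [K.Normal] :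
    Nat.card (K ⊓ Subgroup.centralizer (P : Set G) : Subgroup G) ≤
      Nat.card (K ⊓ Subgroup.centralizer (Q : Set G) : Subgroup G) := by
  obtain ⟨g, rfl⟩ := MulAction.exists_smul_eq G P Q
  refine Nat.card_le_card_of_injective
    (fun k : (K ⊓ Subgroup.centralizer (P : Set G) : Subgroup G) => ⟨g * k.1 * g⁻¹,
      Subgroup.Normal.conj_mem (H := K) ‹_› _ k.2.1 g,
      Subgroup.mem_centralizer_iff.2 fun y hy => ?_⟩) fun k l h => ?_
  · have h₁ := Subgroup.mem_centralizer_iff.1 k.2.2 _ (Sylow.mem_smul_iff.1 hy)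
    have h₂ := congrArg (fun z => g * z * g⁻¹) h₁
    simpa [mul_assoc] using h₂
  · exact Subtype.ext (by simpa using congrArg Subtype.val h)

/-- Every Sylow subgroup of H containing f(x) has exactly |C_K(x)|/|C_K(P)| lifts containing x;
|C_K(P)| does not depend on P. -/
theorem sylowCount_mul_card_centralizer [Finite H] (hf : Function.Surjective f)
    (hK : ¬ p ∣ Nat.card f.ker)
    {x : G} {P : Sylow p G} (hx : x ∈ P) :
    sylowCount p x * Nat.card (f.ker ⊓ Subgroup.centralizer (P : Set G) : Subgroup G) =
      sylowCount p (f x) * Nat.card (f.ker ⊓ Subgroup.centralizer {x} : Subgroup G) := by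
  have := Fintype.ofFinite {Q : Sylow p H // f x ∈ Q}
  let F : {Q : Sylow p G // x ∈ Q} → {Q : Sylow p H // f x ∈ Q} :=
    fun Q => ⟨Q.1.mapSurjective hf, x, Q.2, rfl⟩
  rw [sylowCount, ← Nat.card_congr (Equiv.sigmaFiberEquiv F), Nat.card_sigma, Finset.sum_mul,
    sylowCount, Nat.card_eq_fintype_card (α := {Q : Sylow p H // f x ∈ Q}),
    ← smul_eq_mul (Fintype.card _), ← Finset.card_univ]
  refine Finset.sum_eq_card_nsmul fun Q _ => ?_
  obtain ⟨R, hxR, hR⟩ := Sylow.exists_mem_mapSurjective_eq hf hx Q.2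
  rw [← Sylow.card_mapSurjective_fiber_mul hf hK hxR,
    (Sylow.card_inf_centralizer_le P R f.ker).antisymm (Sylow.card_inf_centralizer_le R P f.ker)]
  congr 1
  refine Nat.card_congr ⟨fun T => ⟨T.1.1, T.1.2, ?_⟩, fun T => ⟨⟨T.1, T.2.1⟩, ?_⟩,
    fun _ => rfl, fun _ => rfl⟩
  · exact (congrArg Subtype.val T.2).trans hR.symm
  · exact Subtype.ext (T.2.2.trans hR)

theorem prod_card_centralizer_pow_dvd (P : Sylow p G) (K : Subgroup G) [K.Normal]
    (hK : ¬ p ∣ Nat.card K) :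
    (∏ᶠ x : P, Nat.card (K ⊓ Subgroup.centralizer {(x : G)} : Subgroup G)) ^ p ∣
      Nat.card K ^ Nat.card P *
        Nat.card (K ⊓ Subgroup.centralizer (P : Set G) : Subgroup G) ^ ((p - 1) * Nat.card P) := by
  let _ : MulDistribMulAction (P : Subgroup G) K :=
    MulDistribMulAction.compHom K ((MulAut.conjNormal (H := K)).comp (P : Subgroup G).subtype)
  have hsmul (x : (P : Subgroup G)) (k : K) : x • k = k ↔ (k : G) * x = x * k := by
    rw [Subtype.ext_iff]
    change (x : G) * k * (x : G)⁻¹ = k ↔ _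
    rw [mul_inv_eq_iff_eq_mul, eq_comm]
  have h : FixedPointBound p (P : Subgroup G) K := .of_coprime P.isPGroup' hK
  have h₁ (x : (P : Subgroup G)) : Nat.card (fixedBySubgroup K x) =
      Nat.card (K ⊓ Subgroup.centralizer {(x : G)} : Subgroup G) :=
    Nat.card_congr ⟨fun k => ⟨k.1.1, k.1.2, Subgroup.mem_centralizer_singleton_iff.2
        ((hsmul x k.1).1 k.2)⟩,
      fun k => ⟨⟨k.1, k.2.1⟩, (hsmul x _).2 (Subgroup.mem_centralizer_singleton_iff.1 k.2.2)⟩,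
      fun _ => rfl, fun _ => rfl⟩
  have h₂ : Nat.card (FixedPoints.subgroup (P : Subgroup G) K) =
      Nat.card (K ⊓ Subgroup.centralizer (P : Set G) : Subgroup G) :=
    Nat.card_congr ⟨fun k => ⟨k.1.1, k.1.2, Subgroup.mem_centralizer_iff.2
        fun x hx => ((hsmul ⟨x, hx⟩ k.1).1 (k.2 _)).symm⟩,
      fun k => ⟨⟨k.1, k.2.1⟩, fun x => (hsmul x _).2
        (Subgroup.mem_centralizer_iff.1 k.2.2 x x.2).symm⟩,
      fun _ => rfl, fun _ => rfl⟩
  rw [FixedPointBound, h₂] at h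
  simp only [h₁] at h
  exact h

theorem SylowProdBound.of_not_dvd_card_ker [Finite H] (hf : Function.Surjective f)
    (hK : ¬ p ∣ Nat.card f.ker) (hH : SylowProdBound p H) : SylowProdBound p G := by
  intro P
  have := Fintype.ofFinite P
  set d := Nat.card (f.ker ⊓ Subgroup.centralizer (P : Set G) : Subgroup G) with hd
  have hd0 : 0 < d := Nat.card_pos
  have h₁ := hH.comp_surjective hf P
  have h₂ := Nat.le_of_dvd
    (Nat.mul_pos (Nat.pow_pos Nat.card_pos) (Nat.pow_pos hd0))
    (prod_card_centralizer_pow_dvd P f.ker hK)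
  -- The counting relation at x = 1.
  have h₃ : Nat.card (Sylow p G) * d = Nat.card (Sylow p H) * Nat.card f.ker := by
    have := sylowCount_mul_card_centralizer hf hK (one_mem P)
    rw [map_one, sylowCount_one, sylowCount_one] at this
    rw [this]
    congr 3
    ext g
    simp [Subgroup.mem_centralizer_singleton_iff]
  have hp : 1 + (p - 1) = p := Nat.add_sub_cancel' (Fact.out : p.Prime).one_le
  rw [finprod_eq_prod_of_fintype] at h₁ h₂ ⊢
  refine Nat.le_of_mul_le_mul_right ?_ (Nat.pow_pos hd0 : 0 < d ^ (p * Nat.card P))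
  calc (∏ x : P, sylowCount p (x : G)) ^ p * d ^ (p * Nat.card P)
      = (∏ x : P, sylowCount p (x : G) * d) ^ p := by
        rw [Finset.prod_mul_distrib, Finset.prod_const, Finset.card_univ, mul_pow, ← pow_mul,
          Nat.card_eq_fintype_card, mul_comm p]
    _ = (∏ x : P, sylowCount p (f x)) ^ p *
          (∏ x : P, Nat.card (f.ker ⊓ Subgroup.centralizer {(x : G)} : Subgroup G)) ^ p := by
        rw [← mul_pow, ← Finset.prod_mul_distrib]
        congr 1
        exact Finset.prod_congr rfl fun x _ => sylowCount_mul_card_centralizer hf hK x.2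
    _ ≤ _ := Nat.mul_le_mul h₁ h₂
    _ = (Nat.card (Sylow p G) * d) ^ Nat.card P * d ^ ((p - 1) * Nat.card P) := by
        rw [h₃, mul_pow, mul_assoc]
    _ = Nat.card (Sylow p G) ^ Nat.card P * d ^ (p * Nat.card P) := by
        rw [mul_pow, mul_assoc, ← pow_add, ← one_add_mul, hp]

end SylowCount

/-! ### Induction along the series. -/

theorem SylowProdBound.of_series {p : ℕ} [Fact p.Prime] (n : ℕ) : ∀ {G : Type*} [Group G] [Finite G]
    (N : ℕ → Subgroup G), N 0 = ⊥ → N n = ⊤ → (∀ i ≤ n, (N i).Normal) →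
      (∀ i < n, N i ≤ N (i + 1) ∧ ((∃ k : ℕ, (N i).relIndex (N (i + 1)) = p ^ k) ∨
        ¬ p ∣ (N i).relIndex (N (i + 1)))) → SylowProdBound p G := by
  induction n with
  | zero =>
    intro G _ _ N h0 hn _ _ P
    have hG : Subsingleton G := by
      rw [← Subgroup.subsingleton_iff]
      exact subsingleton_of_bot_eq_top (h0.symm.trans hn)
    have hS : Subsingleton (Sylow p G) := ⟨fun P Q => Sylow.ext (Subsingleton.elim _ _)⟩
    have := Fintype.ofFinite P
    rw [finprod_eq_prod_of_fintype, Nat.card_of_subsingleton P, one_pow,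
      Finset.prod_eq_one fun x _ => ?_, one_pow]
    rw [Subsingleton.elim (x : G) 1, sylowCount_one, Nat.card_of_subsingleton P]
  | succ n ih =>
    intro G _ _ N h0 hn hN hser
    have hN1 : (N 1).Normal := hN 1 (by omega)
    have hle : ∀ i ≤ n, N 1 ≤ N (i + 1) := by
      intro i
      induction i with
      | zero => exact fun _ => le_rfl
      | succ i ihi => exact fun hi => (ihi (by omega)).trans (hser (i + 1) (by omega)).1
    have hsurj := QuotientGroup.mk'_surjective (N 1)
    have hker : (QuotientGroup.mk' (N 1)).ker = N 1 := QuotientGroup.ker_mk' _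
    have hQ : SylowProdBound p (G ⧸ N 1) := by
      -- The shifted series modulo `N 1` is one step shorter and keeps its relative indices.
      refine ih (fun i => (N (i + 1)).map (QuotientGroup.mk' (N 1))) ?_ ?_ ?_ ?_
      · exact (Subgroup.map_eq_bot_iff _).2 hker.ge
      · rw [hn]
        exact Subgroup.map_top_of_surjective _ hsurj
      · exact fun i hi => (hN (i + 1) (by omega)).map _ hsurj
      · intro i hi
        obtain ⟨h₁, h₂⟩ := hser (i + 1) (by omega)
        refine ⟨Subgroup.map_mono h₁, ?_⟩
        rw [Subgroup.relIndex_map_map, hker, sup_eq_left.2 (hle i (by omega)),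
          sup_eq_left.2 (hle (i + 1) (by omega))]
        exact h₂
    have h₀ := (hser 0 (by omega)).2
    rw [h0, zero_add, Subgroup.relIndex_bot_left] at h₀
    rcases h₀ with ⟨k, hk⟩ | h₀
    · exact hQ.of_isPGroup_ker hsurj (by rw [hker]; exact IsPGroup.of_card hk)
    · exact hQ.of_not_dvd_card_ker hsurj (by rwa [hker])

/-! ### Averaging and double counting. -/

theorem SylowProdBound.rpow_mul_card_le_sum {p : ℕ} [Fact p.Prime] {G : Type*} [Group G] [Finite G]
    (h : SylowProdBound p G) (P : Sylow p G) [Fintype P] :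
    (Nat.card (Sylow p G) : ℝ) ^ (-(1 / (p : ℝ))) * Nat.card P ≤
      ∑ x : P, (sylowCount p (x : G) : ℝ)⁻¹ := by
  have hp : (0 : ℝ) < p := Nat.cast_pos.2 (Fact.out : p.Prime).pos
  have hP : (0 : ℝ) < Nat.card P := Nat.cast_pos.2 Nat.card_pos
  have hn : (0 : ℝ) < Nat.card (Sylow p G) := Nat.cast_pos.2 Nat.card_pos
  have hpos (x : P) : (0 : ℝ) < sylowCount p (x : G) := by
    have : Nonempty {Q : Sylow p G // (x : G) ∈ Q} := ⟨⟨P, x.2⟩⟩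
    exact Nat.cast_pos.2 Nat.card_pos
  have hprod : (0 : ℝ) < ∏ x : P, (sylowCount p (x : G) : ℝ) :=
    Finset.prod_pos fun x _ => hpos x
  have h₁ : (∏ x : P, (sylowCount p (x : G) : ℝ)) ^ p ≤
      (Nat.card (Sylow p G) : ℝ) ^ Nat.card P := by
    have := h P
    rw [finprod_eq_prod_of_fintype] at this
    exact_mod_cast this
  have h₂ : (∏ x : P, (sylowCount p (x : G) : ℝ)) ^ ((Nat.card P : ℝ)⁻¹) ≤
      (Nat.card (Sylow p G) : ℝ) ^ (1 / (p : ℝ)) := by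
    have := Real.rpow_le_rpow (by positivity) h₁
      (by positivity : 0 ≤ (p : ℝ)⁻¹ * (Nat.card P : ℝ)⁻¹)
    rw [← Real.rpow_natCast, ← Real.rpow_natCast, ← Real.rpow_mul hprod.le,
      ← Real.rpow_mul hn.le, mul_inv_cancel_left₀ hp.ne', mul_comm (p : ℝ)⁻¹,
      mul_inv_cancel_left₀ hP.ne'] at this
    rwa [one_div]
  -- AM-GM for the inverse counts turns the bound on the product into a lower bound on the sum.
  have h₃ := Real.geom_mean_le_arith_mean Finset.univ (fun _ : P => (1 : ℝ))
    (fun x : P => (sylowCount p (x : G) : ℝ)⁻¹) (fun _ _ => zero_le_one)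
    (by rw [Finset.sum_const, nsmul_one, Finset.card_univ, ← Nat.card_eq_fintype_card]; exact hP)
    (fun x _ => inv_nonneg.2 (hpos x).le)
  simp only [Real.rpow_one, Finset.prod_inv_distrib, one_mul, Finset.sum_const, nsmul_eq_mul,
    mul_one, Finset.card_univ, ← Nat.card_eq_fintype_card] at h₃
  refine le_trans (mul_le_mul_of_nonneg_right ?_ hP.le) ((le_div_iff₀ hP).1 h₃)
  rw [Real.rpow_neg hn.le]
  exact (inv_anti₀ (by positivity) h₂).trans_eq (Real.inv_rpow hprod.le _).symm

/-- After exchanging the sums, x occurs s(x) times with weight 1/s(x), contributing at most 1. -/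
theorem sum_sylow_sum_inv_sylowCount_le {p : ℕ} {G : Type*} [Group G] [Finite G]
    [Fintype (Sylow p G)] [∀ Q : Sylow p G, Fintype Q] :
    ∑ Q : Sylow p G, ∑ x : Q, (sylowCount p (x : G) : ℝ)⁻¹ ≤ (pElements p G).ncard := by
  classical
  have := Fintype.ofFinite G
  have h₁ (Q : Sylow p G) : ∑ x : Q, (sylowCount p (x : G) : ℝ)⁻¹ =
      ∑ x : G, if x ∈ Q then (sylowCount p x : ℝ)⁻¹ else 0 := by
    rw [← Finset.sum_filter]
    exact (Finset.sum_subtype (p := fun x => x ∈ (Q : Subgroup G)) (Finset.univ.filter (· ∈ Q))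
      (fun x => by rw [Finset.mem_filter_univ]; rfl) fun x => (sylowCount p x : ℝ)⁻¹).symm
  rw [Finset.sum_congr rfl fun Q _ => h₁ Q, Finset.sum_comm, Set.ncard_eq_toFinset_card',
    Finset.card_eq_sum_ones, Nat.cast_sum, ← Finset.sum_filter_add_sum_filter_not Finset.univ
      (· ∈ pElements p G), Finset.sum_eq_zero (s := Finset.univ.filter (· ∉ pElements p G)),
    add_zero, show Finset.univ.filter (· ∈ pElements p G) = (pElements p G).toFinset by ext; simp]
  · refine Finset.sum_le_sum fun x _ => ?_
    rw [← Finset.sum_filter, Finset.sum_const, ← Fintype.card_subtype, ← Nat.card_eq_fintype_card,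
      nsmul_eq_mul, Nat.cast_one]
    exact mul_inv_le_one
  · intro x hx
    refine Finset.sum_eq_zero fun Q _ => if_neg fun hQ => (Finset.mem_filter.1 hx).2 ?_
    exact Set.mem_iUnion.2 ⟨Q, hQ⟩

theorem theorem1p1 (p : ℕ) [Fact p.Prime] (G : Type*) [Group G] [Finite G]
    (hG : IsPSolvable p G) (P : Sylow p G) :
    ((pElements p G).ncard : ℝ) / (Nat.card P : ℝ) ≥
      (Nat.card (Sylow p G) : ℝ) ^ (((p : ℝ) - 1) / (p : ℝ)) := by
  obtain ⟨n, N, h0, hn, hN, hser⟩ := hG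
  have hB : SylowProdBound p G := .of_series n N h0 hn hN hser
  have := Fintype.ofFinite (Sylow p G)
  have (Q : Sylow p G) : Fintype Q := Fintype.ofFinite Q
  have hp : (p : ℝ) ≠ 0 := Nat.cast_ne_zero.2 (Fact.out : p.Prime).ne_zero
  have hP : (0 : ℝ) < Nat.card P := Nat.cast_pos.2 Nat.card_pos
  have hpos : (0 : ℝ) < Nat.card (Sylow p G) := Nat.cast_pos.2 Nat.card_pos
  rw [ge_iff_le, le_div_iff₀ hP]
  refine le_trans ?_ (sum_sylow_sum_inv_sylowCount_le (p := p) (G := G))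
  calc (Nat.card (Sylow p G) : ℝ) ^ (((p : ℝ) - 1) / (p : ℝ)) * Nat.card P
      = ∑ _Q : Sylow p G, (Nat.card (Sylow p G) : ℝ) ^ (-(1 / (p : ℝ))) * Nat.card P := by
        rw [Finset.sum_const, Finset.card_univ, ← Nat.card_eq_fintype_card, nsmul_eq_mul,
          ← mul_assoc, ← Real.rpow_one_add' hpos.le]
        · congr 2
          field_simp
          ring
        · have : (1 : ℝ) < p := Nat.one_lt_cast.2 (Fact.out : p.Prime).one_lt
          have : 1 / (p : ℝ) < 1 := by rw [div_lt_one (by linarith)]; exact this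
          linarith
    -- All Sylow subgroups have the order of P, so the averaged bound applies to each Q.
    _ ≤ _ := Finset.sum_le_sum fun Q _ => by
        rw [Nat.card_congr (P.equiv Q).toEquiv]
        exact hB.rpow_mul_card_le_sum Q
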